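/- Let $D,n\ge 1$ and $N$ be integers, let ${\bm\sigma}=(\sigma_1,\dots,\sigma_D)\in S_n^D$, and for each $c\in\{1,\dots,D\}$ let $i_c(1),\dots,i_c(n)\in\{1,\dots,N\}$ be pairwise distinct. **Notation.** The classical cumulant of finitely many complex random variables $(x_s)_{s\in I}$ is $k\bigl((x_s)_{s\in I}\bigr)=\sum_{\pi}\lambda_\pi\prod_{G\in\pi}\mathbb E\bigl[\prod_{s\in G}x_s\bigr]$, the sum being over all set partitions $\pi$ of $I$, with $\lambda_\pi=(-1)^{\#\pi-1}(\#\pi-1)!$. For $m\le N$, the Weingarten function $W^{(N)}$ on $S_m$ is the inverse, for convolution on $S_m$, of $\rho\mapsto N^{\#\rho}$, where $\#\rho$ is the number of cycles of $\rho$. For permutations, $\Pi(\sigma_c)$ is the partition of $\{1,\dots,n\}$ into the cycles of $\sigma_c$, and $\Pi({\bm\sigma})=\Pi(\sigma_1)\vee\dots\vee\Pi(\sigma_D)$. Regarding $\sigma_c$ as a bijection $\{1,\dots,n\}\to\{\bar1,\dots,\bar n\}$, $s\mapsto\overline{\sigma_c(s)}$, $\Pi_{\mathrm p}({\bm\sigma})$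 is the join over $c$ of the partitions of $\{1,\dots,n,\bar1,\dots,\bar n\}$ into the pairs $\{s,\overline{\sigma_c(s)}\}$. A bipartite partition of this set is one each of whose blocks $G=B\cup\bar B$ has as many unbarred elements (forming $B$) as barred ones (forming $\bar B$). A subscript $|_G$ or $|_B$ denotes restriction to a block. **Mixed case.** Let $A=(A_{\vec i;\vec j})$, $\vec i,\vec j\in\{1,\dots,N\}^D$, be a complex random tensor that is local-unitary invariant, i.e. $(U_1\otimes\cdots\otimes U_D)A(U_1^\dagger\otimes\cdots\otimes U_D^\dagger)$ has the same distribution as $A$ for all $U_1,\dots,U_D\in U(N)$, and whose entries have finite absolute moments of order $n$. With the trace-invariants $$\mathrm{Tr}_{\bm\tau}(A)=\sum_{(\vec i_s),(\vec j_s)}\prod_s A_{i^1_s\dots i^D_s;\,j^1_s\dots j^D_s}\prod_{c=1}^D\prod_s\delta_{i^c_s,\,j^c_{\tau_c(s)}},$$ the mixed finite size free cumulant is $$\mathcal K^{\mathrm m}_{\bm\sigma}[A]=\sum_{{\bm\tau}\in S_n^D}\ \sum_{\pi\ge\Pi({\bm\sigma})\vee\Pi({\bm\tau})}\lambda_\pi\prod_{G\in\pi}\Bigl(\mathbb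 E\bigl[\mathrm{Tr}_{{\bm\tau}|_G}(A)\bigr]\prod_{c=1}^D W^{(N)}\bigl(\sigma_{c|_G}\tau_{c|_G}^{-1}\bigr)\Bigr),$$ where $\pi$ ranges over the set partitions of $\{1,\dots,n\}$. Then $$\mathcal K^{\mathrm m}_{\bm\sigma}[A]=k_n\Bigl(\bigl\{A_{i_1(\sigma_1(s)),\dots,i_D(\sigma_D(s))\,;\,i_1(s),\dots,i_D(s)}\bigr\}_{1\le s\le n}\Bigr).$$ **Pure case.** Let $T=(T_{\vec i})$ and $\bar T=(\bar T_{\vec j})$, $\vec i,\vec j\in\{1,\dots,N\}^D$, be complex random tensors on a common probability space ($\bar T$ need not be the conjugate of $T$) whose joint distribution is local-unitary invariant, i.e. $\bigl((U_1\otimes\cdots\otimes U_D)T,\ \bar T(U_1^\dagger\otimes\cdots\otimes U_D^\dagger)\bigr)$ has the same distribution as $(T,\bar T)$ for all $U_1,\dots,U_D\in U(N)$, and whose entries have finite absolute moments of order $2n$. With $$\mathrm{Tr}_{\bm\tau}(T,\bar T)=\sum_{(\vec i_s),(\vec j_{\bar s})}\prod_s T_{i^1_s\dots i^D_s}\prod_{\bar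 s}\bar T_{j^1_{\bar s}\dots j^D_{\bar s}}\prod_{c=1}^D\prod_s\delta_{i^c_s,\,j^c_{\overline{\tau_c(s)}}},$$ the pure finite size free cumulant is $$\mathcal K_{\bm\sigma}[T,\bar T]=\sum_{\bm\tau}\ \sum_{\Pi\ge\Pi_{\mathrm p}({\bm\sigma})\vee\Pi_{\mathrm p}({\bm\tau})}\lambda_\Pi\prod_{G=B\cup\bar B\in\Pi}\Bigl(\mathbb E\bigl[\mathrm{Tr}_{{\bm\tau}|_B}(T,\bar T)\bigr]\prod_{c=1}^D W^{(N)}\bigl(\sigma_{c|_B}\tau_{c|_B}^{-1}\bigr)\Bigr),$$ where ${\bm\tau}$ ranges over the $D$-tuples of bijections $\{1,\dots,n\}\to\{\bar1,\dots,\bar n\}$ and $\Pi$ over the bipartite partitions. Then $$\mathcal K_{\bm\sigma}[T,\bar T]=k\Bigl(\bigl\{T_{i_1(\sigma_1(s)),\dots,i_D(\sigma_D(s))},\ \bar T_{i_1(s),\dots,i_D(s)}\bigr\}_{1\le s\le n}\Bigr),$$ the classical cumulant of these $2n$ random variables. -/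

import Mathlib

open MeasureTheory ProbabilityTheory

namespace TensorCumulant

noncomputable section

open scoped Classical in
/-- There are finitely many set partitions (equivalence relations) of a finite set. -/
instance instFintypeSetoid (ι : Type*) [Fintype ι] : Fintype (Setoid ι) :=
  Fintype.ofInjective (fun (r : Setoid ι) (a b : ι) => r a b)
    (fun _ _ h => Setoid.ext fun a b => iff_of_eq (congrFun (congrFun h a) b))

/-- A set partition `π` of a finite set has finitely many blocks; the blocks are the elements
of `Quotient π`. -/
instance instFintypeBlocks {ι : Type*} [Fintype ι] (π : Setoid ι) : Fintype (Quotient π) :=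
  Fintype.ofFinite _

/-- The elements of the block `G` of the partition `π`. -/
abbrev Block {ι : Type*} (π : Setoid ι) (G : Quotient π) : Type _ :=
  {s : ι // (Quotient.mk π s) = G}

instance instFintypeBlock {ι : Type*} [Fintype ι] (π : Setoid ι) (G : Quotient π) :
    Fintype (Block π G) :=
  Fintype.ofFinite _

/-- The Möbius function `λ_π = (-1)^(#π - 1) (#π - 1)!` on the lattice of set partitions. -/
def moebius {ι : Type*} [Fintype ι] (π : Setoid ι) : ℂ :=
  (-1) ^ (Fintype.card (Quotient π) - 1) * (Nat.factorial (Fintype.card (Quotient π) - 1) : ℂ)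

/-- The classical (joint) cumulant of the complex random variables `x s`, `s ∈ ι`. -/
def classicalCumulant {Ω : Type*} [MeasurableSpace Ω] (μ : Measure Ω) {ι : Type*} [Fintype ι]
    (x : ι → Ω → ℂ) : ℂ :=
  ∑ π : Setoid ι, moebius π * ∏ G : Quotient π, ∫ ω, ∏ s : Block π G, x s.1 ω ∂μ

/-! ### Weingarten functions -/

/-- The number of disjoint cycles of `ρ`, fixed points included. -/
def numCycles {ι : Type*} [Fintype ι] (ρ : Equiv.Perm ι) : ℕ :=
  Fintype.card (Quotient (Equiv.Perm.SameCycle.setoid ρ))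

/-- The Gram matrix `N ^ #(σ τ⁻¹)`. -/
def gram (N : ℕ) (ι : Type*) [Fintype ι] : Matrix (Equiv.Perm ι) (Equiv.Perm ι) ℂ :=
  Matrix.of fun σ τ => (N : ℂ) ^ numCycles (σ * τ⁻¹)

open scoped Classical in
/-- The Weingarten function `W^(N)`: the inverse of `ρ ↦ N ^ #ρ = N ^ (n - |ρ|)` for the convolution
product on the symmetric group of `ι`, whose geometric expansion is the usual `1/N` series.
It exists when `card ι ≤ N`, see `sum_gram_mul_weingarten`. -/
def weingarten (N : ℕ) {ι : Type*} [Fintype ι] (ν : Equiv.Perm ι) : ℂ :=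
  (gram N ι)⁻¹ ν 1

open scoped Classical in
theorem card_invariant_colourings (N : ℕ) {ι : Type*} [Fintype ι] (σ τ : Equiv.Perm ι) :
    (Finset.univ.filter fun f : ι → Fin N => f ∘ σ = f ∘ τ).card = N ^ numCycles (σ * τ⁻¹) := by
  let r := Equiv.Perm.SameCycle.setoid (σ * τ⁻¹)
  have key : ∀ f : ι → Fin N, f ∘ σ = f ∘ τ ↔ ∀ a b, r a b → f a = f b := by
    intro f
    constructor
    · intro h a b hab
      have h1 : ∀ x, f ((σ * τ⁻¹) x) = f x := fun x => by
        have := congrFun h (τ⁻¹ x)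
        simpa using this
      obtain ⟨k, rfl⟩ := hab.exists_nat_pow_eq
      clear hab
      induction k with
      | zero => rfl
      | succ k ih => rw [pow_succ', Equiv.Perm.mul_apply, h1]; exact ih
    · intro h
      funext x
      have := h ((σ * τ⁻¹) (τ x)) (τ x)
        ((Equiv.Perm.sameCycle_apply_left).2 (Equiv.Perm.SameCycle.refl _ _))
      simpa using this
  have e : {f : ι → Fin N // f ∘ σ = f ∘ τ} ≃ (Quotient r → Fin N) :=
    { toFun := fun f => Quotient.lift f.1 ((key f.1).1 f.2)
      invFun := fun g => ⟨fun a => g (Quotient.mk r a),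
        (key _).2 fun a b hab => congrArg g (Quotient.sound hab)⟩
      left_inv := fun f => rfl
      right_inv := fun g => by
        funext q
        induction q using Quotient.inductionOn
        rfl }
  rw [← Fintype.card_subtype, Fintype.card_congr e, Fintype.card_fun, Fintype.card_fin]
  rfl

open scoped Classical ComplexOrder in
theorem isUnit_gram (N : ℕ) {ι : Type*} [Fintype ι] (h : Fintype.card ι ≤ N) :
    IsUnit (gram N ι) := by
  let B : Matrix ((ι → Fin N) × (ι → Fin N)) (Equiv.Perm ι) ℂ :=
    Matrix.of fun p τ => if p.1 ∘ τ = p.2 then 1 else 0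
  have hB : gram N ι = B.conjTranspose * B := by
    ext σ τ
    rw [Matrix.mul_apply, Fintype.sum_prod_type]
    have h1 : ∀ f : ι → Fin N,
        ∑ g : ι → Fin N, B.conjTranspose σ (f, g) * B (f, g) τ =
          if f ∘ σ = f ∘ τ then 1 else 0 := by
      intro f
      rw [Finset.sum_eq_single (f ∘ τ)]
      · simp [B, Matrix.conjTranspose_apply]
      · intro g _ hg
        simp [B, hg.symm]
      · simp
    simp_rw [h1]
    rw [Finset.sum_boole, card_invariant_colourings]
    simp [gram]
  have hinj : Function.Injective B.mulVec := by
    rw [← Matrix.coe_mulVecLin, ← LinearMap.ker_eq_bot, LinearMap.ker_eq_bot']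
    intro x hx
    obtain ⟨f⟩ : Nonempty (ι ↪ Fin N) :=
      Function.Embedding.nonempty_of_card_le (by simpa using h)
    funext τ
    have h2 := congrFun hx (f, f ∘ τ)
    rw [Matrix.mulVecLin_apply, Matrix.mulVec, dotProduct, Finset.sum_eq_single τ] at h2
    · simpa [B] using h2
    · intro ρ _ hρ
      have : ¬ (f : ι → Fin N) ∘ ρ = f ∘ τ := fun h3 =>
        hρ (Equiv.ext fun a => f.injective (congrFun h3 a))
      simp [B, this]
    · simp
  rw [hB]
  exact (Matrix.PosDef.conjTranspose_mul_self B hinj).isUnit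

open scoped Classical in
theorem sum_gram_mul_weingarten (N : ℕ) {ι : Type*} [Fintype ι] (h : Fintype.card ι ≤ N)
    (σ τ : Equiv.Perm ι) :
    ∑ ρ : Equiv.Perm ι, (N : ℂ) ^ numCycles (σ * ρ⁻¹) * weingarten N (ρ * τ⁻¹)
      = if σ = τ then 1 else 0 := by
  have hinv : ∀ ρ : Equiv.Perm ι, weingarten N (ρ * τ⁻¹) = (gram N ι)⁻¹ ρ τ := by
    intro ρ
    have h1 : (gram N ι).submatrix (Equiv.mulRight τ) (Equiv.mulRight τ) = gram N ι := by
      ext a b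
      simp [gram, mul_assoc]
    have h2 := congrFun (congrFun
      (Matrix.inv_submatrix_equiv (gram N ι) (Equiv.mulRight τ) (Equiv.mulRight τ)) (ρ * τ⁻¹)) 1
    rw [h1] at h2
    simpa [weingarten] using h2
  have h3 := congrFun (congrFun (Matrix.mul_nonsing_inv (gram N ι)
    ((Matrix.isUnit_iff_isUnit_det _).1 (isUnit_gram N h))) σ) τ
  rw [Matrix.mul_apply, Matrix.one_apply] at h3
  rw [← h3]
  exact Finset.sum_congr rfl fun ρ _ => by rw [hinv]; rfl

/-! ### Mixed tensors -/

/-- A `D`-tuple of indices in `{1, …, N}`. -/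
abbrev MultiIndex (D N : ℕ) : Type := Fin D → Fin N

/-- Mixed tensors `A_{i¹ … i^D ; j¹ … j^D}`: output indices first, then input indices. -/
abbrev MixedTensor (D N : ℕ) : Type := MultiIndex D N → MultiIndex D N → ℂ

/-- Pure tensors `T_{i¹ … i^D}`. -/
abbrev PureTensor (D N : ℕ) : Type := MultiIndex D N → ℂ

/-- The entries of `U₁ ⊗ ⋯ ⊗ U_D`. -/
def tensorEntry {D N : ℕ} (U : Fin D → Matrix.unitaryGroup (Fin N) ℂ) (i k : MultiIndex D N) : ℂ :=
  ∏ c : Fin D, (U c : Matrix (Fin N) (Fin N) ℂ) (i c) (k c)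

/-- `(U₁ ⊗ ⋯ ⊗ U_D) A (U₁† ⊗ ⋯ ⊗ U_D†)`. -/
def mixedAction {D N : ℕ} (U : Fin D → Matrix.unitaryGroup (Fin N) ℂ) (A : MixedTensor D N) :
    MixedTensor D N :=
  fun i j => ∑ k, ∑ l, tensorEntry U i k * A k l * star (tensorEntry U j l)

/-- Local-unitary invariance of the distribution of a mixed random tensor. -/
def MixedLUInvariant {Ω : Type*} [MeasurableSpace Ω] (μ : Measure Ω) {D N : ℕ}
    (A : Ω → MixedTensor D N) : Prop :=
  ∀ U : Fin D → Matrix.unitaryGroup (Fin N) ℂ,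
    IdentDistrib (fun ω => mixedAction U (A ω)) A μ μ

open scoped Classical in
/-- The trace-invariant `Tr_σ(A)`, for copies of `A` labelled by `ι`. -/
def mixedTrace {D N : ℕ} {ι : Type*} [Fintype ι] (σ : Fin D → Equiv.Perm ι)
    (A : MixedTensor D N) : ℂ :=
  ∑ i : ι → MultiIndex D N, ∑ j : ι → MultiIndex D N,
    (∏ s, A (i s) (j s)) * ∏ c, ∏ s, if i s c = j (σ c s) c then 1 else 0

/-- `Π(σ) = Π(σ₁) ∨ ⋯ ∨ Π(σ_D)`, the join of the partitions into cycles. -/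
def mixedPartition {D : ℕ} {ι : Type*} (σ : Fin D → Equiv.Perm ι) : Setoid ι :=
  ⨆ c, Equiv.Perm.SameCycle.setoid (σ c)

theorem mk_apply_eq_iff_mixed {D : ℕ} {ι : Type*} {σ : Fin D → Equiv.Perm ι} {π : Setoid ι}
    (h : mixedPartition σ ≤ π) (c : Fin D) (G : Quotient π) (s : ι) :
    Quotient.mk π (σ c s) = G ↔ Quotient.mk π s = G := by
  have hs : Quotient.mk π (σ c s) = Quotient.mk π s := Quotient.sound
    (h ((le_iSup (fun c => Equiv.Perm.SameCycle.setoid (σ c)) c)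
      ((Equiv.Perm.sameCycle_apply_left).2 (Equiv.Perm.SameCycle.refl (σ c) s))))
  rw [hs]

/-- The permutations induced by `σ` on the block `G` of a partition `π ≥ Π(σ)`. -/
def mixedRestrict {D : ℕ} {ι : Type*} (σ : Fin D → Equiv.Perm ι) (π : Setoid ι)
    (h : mixedPartition σ ≤ π) (G : Quotient π) : Fin D → Equiv.Perm (Block π G) :=
  fun c => (σ c).subtypePerm fun s => mk_apply_eq_iff_mixed h c G s

open scoped Classical in
/-- The mixed finite size free cumulant `K^m_σ[A]`. -/
def mixedFreeCumulant {Ω : Type*} [MeasurableSpace Ω] (μ : Measure Ω) {D N : ℕ}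
    {ι : Type*} [Fintype ι] (σ : Fin D → Equiv.Perm ι) (A : Ω → MixedTensor D N) : ℂ :=
  ∑ τ : Fin D → Equiv.Perm ι,
    ∑ π : {π : Setoid ι // mixedPartition σ ≤ π ∧ mixedPartition τ ≤ π},
      moebius π.1 * ∏ G : Quotient π.1,
        (∫ ω, mixedTrace (mixedRestrict τ π.1 π.2.2 G) (A ω) ∂μ) *
          ∏ c, weingarten N
            (mixedRestrict σ π.1 π.2.1 G c * (mixedRestrict τ π.1 π.2.2 G c)⁻¹)

/-! ### Pure tensors

White labels are the elements of `α` and black labels those of `β`; permutations are seen as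
bijections from white to black labels. -/

/-- `(U₁ ⊗ ⋯ ⊗ U_D) T`. -/
def whiteAction {D N : ℕ} (U : Fin D → Matrix.unitaryGroup (Fin N) ℂ) (T : PureTensor D N) :
    PureTensor D N :=
  fun i => ∑ k, tensorEntry U i k * T k

/-- `T' (U₁† ⊗ ⋯ ⊗ U_D†)`. -/
def blackAction {D N : ℕ} (U : Fin D → Matrix.unitaryGroup (Fin N) ℂ) (T' : PureTensor D N) :
    PureTensor D N :=
  fun j => ∑ l, T' l * star (tensorEntry U j l)

/-- Local-unitary invariance of the joint distribution of a pair of pure random tensors. -/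
def PureLUInvariant {Ω : Type*} [MeasurableSpace Ω] (μ : Measure Ω) {D N : ℕ}
    (T T' : Ω → PureTensor D N) : Prop :=
  ∀ U : Fin D → Matrix.unitaryGroup (Fin N) ℂ,
    IdentDistrib (fun ω => (whiteAction U (T ω), blackAction U (T' ω)))
      (fun ω => (T ω, T' ω)) μ μ

open scoped Classical in
/-- The trace-invariant `Tr_σ(T, T')`. -/
def pureTrace {D N : ℕ} {α β : Type*} [Fintype α] [Fintype β] (σ : Fin D → α ≃ β)
    (T T' : PureTensor D N) : ℂ :=
  ∑ i : α → MultiIndex D N, ∑ j : β → MultiIndex D N,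
    ((∏ s, T (i s)) * ∏ t, T' (j t)) * ∏ c, ∏ s, if i s c = j (σ c s) c then 1 else 0

/-- `Π_p(σ) = Π_p(σ₁) ∨ ⋯ ∨ Π_p(σ_D)`, where `Π_p(σ_c)` is the partition of the white and black
labels into the pairs `{s, σ_c(s)}`. -/
def purePartition {D : ℕ} {α β : Type*} (σ : Fin D → α ≃ β) : Setoid (α ⊕ β) :=
  ⨆ c, Setoid.ker (Sum.elim (σ c) id)

/-- The white elements of a block. -/
abbrev WhiteBlock {α β : Type*} (P : Setoid (α ⊕ β)) (G : Quotient P) : Type _ :=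
  {s : α // (Quotient.mk P (Sum.inl s)) = G}

/-- The black elements of a block. -/
abbrev BlackBlock {α β : Type*} (P : Setoid (α ⊕ β)) (G : Quotient P) : Type _ :=
  {t : β // (Quotient.mk P (Sum.inr t)) = G}

instance instFintypeWhiteBlock {α β : Type*} [Fintype α] (P : Setoid (α ⊕ β)) (G : Quotient P) :
    Fintype (WhiteBlock P G) :=
  Fintype.ofFinite _

instance instFintypeBlackBlock {α β : Type*} [Fintype β] (P : Setoid (α ⊕ β)) (G : Quotient P) :
    Fintype (BlackBlock P G) :=
  Fintype.ofFinite _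

/-- Bipartite partitions: every block has as many white as black elements. -/
def IsBipartite {α β : Type*} [Fintype α] [Fintype β] (P : Setoid (α ⊕ β)) : Prop :=
  ∀ G : Quotient P, Fintype.card (WhiteBlock P G) = Fintype.card (BlackBlock P G)

theorem mk_inl_eq_iff_pure {D : ℕ} {α β : Type*} {σ : Fin D → α ≃ β} {P : Setoid (α ⊕ β)}
    (h : purePartition σ ≤ P) (c : Fin D) (G : Quotient P) (s : α) :
    Quotient.mk P (Sum.inl s) = G ↔ Quotient.mk P (Sum.inr (σ c s)) = G := by
  have hs : Quotient.mk P (Sum.inl s) = Quotient.mk P (Sum.inr (σ c s)) := Quotient.sound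
    (h ((le_iSup (fun c => Setoid.ker (Sum.elim (σ c) (id : β → β))) c)
      (show Sum.elim (σ c) id (Sum.inl s) = Sum.elim (σ c) id (Sum.inr (σ c s)) from rfl)))
  rw [hs]

/-- The bijections induced by `σ` from the white to the black elements of a block of a partition
`P ≥ Π_p(σ)`. -/
def pureRestrict {D : ℕ} {α β : Type*} (σ : Fin D → α ≃ β) (P : Setoid (α ⊕ β))
    (h : purePartition σ ≤ P) (G : Quotient P) : Fin D → WhiteBlock P G ≃ BlackBlock P G :=
  fun c => (σ c).subtypeEquiv fun s => mk_inl_eq_iff_pure h c G s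

open scoped Classical in
/-- The pure finite size free cumulant `K_σ[T, T']`.  Note that `e.symm.trans f` is the
permutation `f e⁻¹` of the black elements. -/
def pureFreeCumulant {Ω : Type*} [MeasurableSpace Ω] (μ : Measure Ω) {D N : ℕ}
    {α β : Type*} [Fintype α] [Fintype β] (σ : Fin D → α ≃ β) (T T' : Ω → PureTensor D N) : ℂ :=
  ∑ τ : Fin D → α ≃ β,
    ∑ P : {P : Setoid (α ⊕ β) // IsBipartite P ∧ purePartition σ ≤ P ∧ purePartition τ ≤ P},
      moebius P.1 * ∏ G : Quotient P.1,
        (∫ ω, pureTrace (pureRestrict τ P.1 P.2.2.2 G) (T ω) (T' ω) ∂μ) *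
          ∏ c, weingarten N
            ((pureRestrict τ P.1 P.2.2.2 G c).symm.trans (pureRestrict σ P.1 P.2.2.1 G c))

end

end TensorCumulant

namespace TensorCumulant

/-! Mixed and pure moments are both entries `M k l` of a possibly rectangular matrix, with white
indices `k` and black indices `l`, invariant under all `U₁ ⊗ ⋯ ⊗ U_D`. The core is an elementary
description of such matrices, with no Haar integration or Schur-Weyl duality.

Invariance under diagonal unitaries kills `M k l` unless, for each colour, `k` and `l` take the same
values with the same multiplicities (`IsUnitaryInvariant.exists_equiv`). Hence `M` intertwines
tensor powers of arbitrary diagonal matrices, and so of 0-1 matrices of functions, each being a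
diagonal matrix times a unitary. A function sends pairwise distinct indices `j` to any prescribed
`l`; this expresses every entry of `M` through its entries at permutations of `j`
(`IsUnitaryInvariant.apply_eq_sum`). Tracing turns that expansion into a linear system with matrix
the product over colours of Gram matrices, which the Weingarten functions invert
(`IsUnitaryInvariant.apply_eq_sum_trace`).

For the cumulants, fix the partition and sum over `τ` first. If the partition is preserved by `σ`,
the sum factorises over blocks, and each factor is the moment just computed. Otherwise no `τ`
contributes, and the product of moments vanishes by the multiplicity argument. -/

/-! ### Tensor powers of matrices -/

/-- The tensor power `⨂ₛ (X₁ ⊗ ⋯ ⊗ X_D)` over the labels `s ∈ α`, as a matrix. -/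
def tensorPower {D N : ℕ} (α : Type*) [Fintype α] (X : Fin D → Matrix (Fin N) (Fin N) ℂ) :
    Matrix (α → MultiIndex D N) (α → MultiIndex D N) ℂ :=
  Matrix.of fun k k' => ∏ s, ∏ c, X c (k s c) (k' s c)

section TensorPower

variable {D N : ℕ} {α : Type*} [Fintype α]

open scoped Classical in
theorem tensorPower_mul (X Y : Fin D → Matrix (Fin N) (Fin N) ℂ) :
    tensorPower α (fun c => X c * Y c) = tensorPower α X * tensorPower α Y := by
  ext k k'
  simp only [tensorPower, Matrix.of_apply, Matrix.mul_apply, Finset.prod_univ_sum,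
    Fintype.piFinset_univ, Finset.prod_mul_distrib]

theorem tensorPower_diagonal (d : Fin D → Fin N → ℂ) :
    tensorPower α (fun c => Matrix.diagonal (d c)) =
      Matrix.diagonal fun k => ∏ s, ∏ c, d c (k s c) := by
  ext k k'
  by_cases h : k = k'
  · subst h
    simp [tensorPower]
  · rw [Matrix.diagonal_apply_ne _ h]
    obtain ⟨s, hs⟩ := Function.ne_iff.1 h
    obtain ⟨c, hc⟩ := Function.ne_iff.1 hs
    exact Finset.prod_eq_zero (Finset.mem_univ s)
      (Finset.prod_eq_zero (Finset.mem_univ c) (Matrix.diagonal_apply_ne _ hc))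

theorem tensorPower_one :
    tensorPower α (fun _ : Fin D => (1 : Matrix (Fin N) (Fin N) ℂ)) = 1 := by
  have := tensorPower_diagonal (α := α) (fun (_ : Fin D) (_ : Fin N) => (1 : ℂ))
  simpa using this

theorem tensorPower_conjTranspose (X : Fin D → Matrix (Fin N) (Fin N) ℂ) :
    (tensorPower α X).conjTranspose = tensorPower α fun c => (X c).conjTranspose := by
  ext k k'
  simp [tensorPower, Matrix.conjTranspose_apply]

open scoped Classical in
theorem conjTranspose_tensorPower_mul_self (U : Fin D → Matrix.unitaryGroup (Fin N) ℂ) :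
    (tensorPower α fun c => (U c : Matrix (Fin N) (Fin N) ℂ)).conjTranspose *
      (tensorPower α fun c => (U c : Matrix (Fin N) (Fin N) ℂ)) = 1 := by
  rw [tensorPower_conjTranspose, ← tensorPower_mul, ← tensorPower_one]
  congr 1
  funext c
  exact Matrix.mem_unitaryGroup_iff'.1 (U c).2

end TensorPower

/-! ### Matrices of functions between indices -/

/-- The `0`-`1` matrix of a function `f`, sending the basis vector `b` to `f b`. -/
def functionMatrix {N : ℕ} (f : Fin N → Fin N) : Matrix (Fin N) (Fin N) ℂ :=
  Matrix.of fun a b => if a = f b then 1 else 0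

theorem tensorPower_functionMatrix {D N : ℕ} {α : Type*} [Fintype α]
    (f : Fin D → Fin N → Fin N) (k k' : α → MultiIndex D N) :
    tensorPower α (fun c => functionMatrix (f c)) k k' =
      if k = (fun s c => f c (k' s c)) then 1 else 0 := by
  simp only [tensorPower, functionMatrix, Matrix.of_apply, Finset.prod_ite_zero,
    Finset.prod_const_one, Finset.mem_univ, true_implies]
  congr 1
  simp [funext_iff]

theorem sum_star_mul_eq_inner {N : ℕ} (x y : EuclideanSpace ℂ (Fin N)) :
    ∑ a, x a * star (y a) = inner ℂ y x := by
  simp [PiLp.inner_apply]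

/-- The rows of a function matrix are orthogonal, so it is a diagonal matrix times a unitary. -/
theorem exists_functionMatrix_eq_diagonal_mul {N : ℕ} (f : Fin N → Fin N) :
    ∃ (d : Fin N → ℂ) (V : Matrix.unitaryGroup (Fin N) ℂ),
      functionMatrix f = Matrix.diagonal d * (V : Matrix (Fin N) (Fin N) ℂ) := by
  -- Row `b` of the matrix is the indicator of the fibre of `f` over `b`, so `m b` is its norm.
  -- Distinct fibres are disjoint, hence the normalised nonzero rows are orthonormal.
  let m : Fin N → ℝ := fun b => √((Finset.univ.filter fun a => b = f a).card : ℝ)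
  let v : Fin N → EuclideanSpace ℂ (Fin N) := fun b =>
    WithLp.toLp 2 fun a => if b = f a then ((m b)⁻¹ : ℂ) else 0
  have hm : ∀ b ∈ Set.range f, (m b : ℂ) ≠ 0 := by
    rintro _ ⟨a, rfl⟩
    rw [Complex.ofReal_ne_zero]
    refine (Real.sqrt_pos.2 ?_).ne'
    exact_mod_cast Finset.card_pos.2 ⟨a, by simp⟩
  have hmm : ∀ b, (m b : ℂ) * m b = ((Finset.univ.filter fun a => b = f a).card : ℂ) := fun b => by
    rw [← Complex.ofReal_mul, Real.mul_self_sqrt (Nat.cast_nonneg _)]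
    simp
  have hv : Orthonormal ℂ ((Set.range f).domRestrict v) := by
    rw [orthonormal_iff_ite]
    rintro ⟨b, hb⟩ ⟨b', hb'⟩
    rw [Set.domRestrict_apply, Set.domRestrict_apply, ← sum_star_mul_eq_inner]
    by_cases h : b = b'
    · subst h
      simp only [v, if_true]
      have : ∀ a, (if b = f a then ((m b)⁻¹ : ℂ) else 0) *
          star (if b = f a then ((m b)⁻¹ : ℂ) else 0) =
            if b = f a then ((m b : ℂ) * m b)⁻¹ else 0 := fun a => by
        split_ifs <;> simp
      rw [Finset.sum_congr rfl fun a _ => this a, ← Finset.sum_filter, Finset.sum_const,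
        nsmul_eq_mul, ← hmm, mul_inv_cancel₀ (mul_ne_zero (hm b hb) (hm b hb))]
    · rw [if_neg (by simpa using h)]
      refine Finset.sum_eq_zero fun a _ => ?_
      by_cases h1 : b' = f a
      · have h2 : b ≠ f a := fun h2 => h (h2.trans h1.symm)
        simp [v, h2]
      · simp [v, h1]
  -- The rows of the unitary outside the range of `f` are arbitrary: they are multiplied by `m b =
  -- 0`.
  obtain ⟨e, he⟩ := hv.exists_orthonormalBasis_extension_of_card_eq (by simp)
  refine ⟨fun b => m b, ⟨Matrix.of fun b a => e b a, ?_⟩, ?_⟩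
  · rw [Matrix.mem_unitaryGroup_iff]
    ext b b'
    rw [Matrix.mul_apply]
    simp only [Matrix.star_apply, Matrix.of_apply]
    rw [sum_star_mul_eq_inner, orthonormal_iff_ite.1 e.orthonormal, Matrix.one_apply]
    simp [eq_comm]
  · ext b a
    rw [Matrix.diagonal_mul]
    simp only [functionMatrix, Matrix.of_apply]
    by_cases hb : b ∈ Set.range f
    · rw [he b hb]
      simp only [v]
      split_ifs
      · rw [mul_inv_cancel₀ (hm b hb)]
      · simp
    · have h0 : m b = 0 := by
        have : (Finset.univ.filter fun a => b = f a) = ∅ :=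
          Finset.filter_eq_empty_iff.2 fun a _ h => hb ⟨a, h.symm⟩
        simp [m, this]
      rw [if_neg fun h => hb ⟨a, h.symm⟩, h0]
      simp

/-! ### Invariant matrices -/

open scoped Classical in
/-- Invariance of `M` under all `U₁ ⊗ ⋯ ⊗ U_D`, acting on the white labels `α` and, by the
adjoint, on the black labels `β`. -/
def IsUnitaryInvariant {D N : ℕ} {α β : Type*} [Fintype α] [Fintype β]
    (M : Matrix (α → MultiIndex D N) (β → MultiIndex D N) ℂ) : Prop :=
  ∀ U : Fin D → Matrix.unitaryGroup (Fin N) ℂ,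
    tensorPower α (fun c => (U c : Matrix (Fin N) (Fin N) ℂ)) * M *
      (tensorPower β fun c => (U c : Matrix (Fin N) (Fin N) ℂ)).conjTranspose = M

section Invariant

variable {D N : ℕ} {α β : Type*} [Fintype α] [Fintype β]
  {M : Matrix (α → MultiIndex D N) (β → MultiIndex D N) ℂ}

open scoped Classical in
theorem IsUnitaryInvariant.comm (hM : IsUnitaryInvariant M)
    (U : Fin D → Matrix.unitaryGroup (Fin N) ℂ) :
    tensorPower α (fun c => (U c : Matrix (Fin N) (Fin N) ℂ)) * M =
      M * tensorPower β fun c => (U c : Matrix (Fin N) (Fin N) ℂ) := by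
  conv_rhs => rw [← hM U]
  rw [Matrix.mul_assoc _ _ (tensorPower β _), conjTranspose_tensorPower_mul_self, Matrix.mul_one]

theorem diagonal_mem_unitaryGroup {d : Fin N → ℂ} (hd : ∀ a, ‖d a‖ = 1) :
    Matrix.diagonal d ∈ Matrix.unitaryGroup (Fin N) ℂ := by
  rw [Matrix.mem_unitaryGroup_iff, Matrix.star_eq_conjTranspose, Matrix.diagonal_conjTranspose,
    Matrix.diagonal_mul_diagonal, ← Matrix.diagonal_one]
  congr 1
  funext a
  simp [Complex.mul_conj, Complex.normSq_eq_norm_sq, hd]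

/-- A non-zero entry of an invariant matrix has equal white and black weights. -/
theorem IsUnitaryInvariant.exists_equiv (hM : IsUnitaryInvariant M) {k : α → MultiIndex D N}
    {l : β → MultiIndex D N} (h : M k l ≠ 0) :
    ∃ σ : Fin D → α ≃ β, ∀ c s, k s c = l (σ c s) c := by
  classical
  have hcard : ∀ c a, Fintype.card {s // k s c = a} = Fintype.card {t // l t c = a} := by
    intro c a
    -- The order of the root of unity exceeds both multiplicities, so equal powers of `z` have equal
    -- exponents.
    let m := Fintype.card α + Fintype.card β + 1
    have hz := Complex.isPrimitiveRoot_exp m (Nat.succ_ne_zero _)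
    set z := Complex.exp (2 * Real.pi * Complex.I / m)
    -- This phase acts only on colour `c` and value `a`; its tensor power multiplies an entry by `z`
    -- to the multiplicity of `a`.
    let d : Fin D → Fin N → ℂ := fun c' a' => if c' = c ∧ a' = a then z else 1
    have hd : ∀ c' a', ‖d c' a'‖ = 1 := by
      intro c' a'
      simp only [d]
      split_ifs
      · exact hz.norm'_eq_one (Nat.succ_ne_zero _)
      · simp
    have h1 := congrFun (congrFun
      (hM.comm fun c' => ⟨Matrix.diagonal (d c'), diagonal_mem_unitaryGroup (hd c')⟩) k) l
    simp only [tensorPower_diagonal, Matrix.diagonal_mul, Matrix.mul_diagonal] at h1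
    rw [mul_comm] at h1
    have h2 := mul_left_cancel₀ h h1
    have h3 : ∀ x : MultiIndex D N, ∏ c', d c' (x c') = if x c = a then z else 1 := by
      intro x
      rw [Finset.prod_eq_single c]
      · simp [d]
      · intro c' _ hc'
        simp [d, hc']
      · simp
    simp only [h3, Finset.prod_ite, Finset.prod_const, one_pow, mul_one] at h2
    have h4 := hz.pow_inj
      (Nat.lt_succ_of_le ((Finset.card_le_univ _).trans (Nat.le_add_right _ _)))
      (Nat.lt_succ_of_le ((Finset.card_le_univ _).trans (Nat.le_add_left _ _))) h2
    rw [Fintype.card_subtype, Fintype.card_subtype, h4]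
  refine ⟨fun c => Equiv.ofFiberEquiv (f := fun s => k s c) (g := fun t => l t c)
    fun a => Fintype.equivOfCardEq (hcard c a), fun c s => ?_⟩
  exact (Equiv.ofFiberEquiv_map (f := fun s => k s c) (g := fun t => l t c) _ s).symm

-- On the support of `M` the white and black indices agree up to a bijection in each colour, so both
-- diagonal factors are the same product. The entries of `d` need not have modulus one; zeros are
-- needed for non-surjective functions.
open scoped Classical in
theorem IsUnitaryInvariant.comm_diagonal (hM : IsUnitaryInvariant M) (d : Fin D → Fin N → ℂ) :
    tensorPower α (fun c => Matrix.diagonal (d c)) * M =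
      M * tensorPower β fun c => Matrix.diagonal (d c) := by
  ext k l
  rw [tensorPower_diagonal, tensorPower_diagonal, Matrix.diagonal_mul, Matrix.mul_diagonal]
  by_cases h : M k l = 0
  · simp [h]
  · obtain ⟨σ, hσ⟩ := hM.exists_equiv h
    rw [mul_comm]
    congr 1
    rw [Finset.prod_comm, Finset.prod_comm (s := (Finset.univ : Finset β))]
    refine Finset.prod_congr rfl fun c _ => ?_
    simp only [hσ]
    exact (σ c).prod_comp fun t => d c (l t c)

open scoped Classical in
theorem IsUnitaryInvariant.comm_functionMatrix (hM : IsUnitaryInvariant M)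
    (f : Fin D → Fin N → Fin N) :
    tensorPower α (fun c => functionMatrix (f c)) * M =
      M * tensorPower β fun c => functionMatrix (f c) := by
  choose d V h using fun c => exists_functionMatrix_eq_diagonal_mul (f c)
  simp only [h]
  rw [tensorPower_mul, tensorPower_mul, Matrix.mul_assoc, hM.comm, ← Matrix.mul_assoc,
    hM.comm_diagonal, Matrix.mul_assoc]

open scoped Classical in
/-- An invariant matrix is a combination of permutation tensors, whose coefficients are its
entries at pairwise distinct indices. -/
theorem IsUnitaryInvariant.apply_eq_sum (hM : IsUnitaryInvariant M) {j : Fin D → β → Fin N}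
    (hj : ∀ c, Function.Injective (j c)) (k : α → MultiIndex D N) (l : β → MultiIndex D N) :
    M k l = ∑ σ : Fin D → α ≃ β,
      M (fun s c => j c (σ c s)) (fun t c => j c t) *
        if ∀ c s, k s c = l (σ c s) c then 1 else 0 := by
  -- Injectivity of `j c` makes `f` well defined; its values off the range of `j c` are irrelevant.
  have hf : ∀ c, ∃ f : Fin N → Fin N, ∀ t, f (j c t) = l t c := fun c =>
    ⟨fun a => if h : ∃ t, j c t = a then l h.choose c else a, fun t => by
      have h : ∃ t', j c t' = j c t := ⟨t, rfl⟩
      simp only [dif_pos h, hj c h.choose_spec]⟩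
  choose f hf using hf
  -- At the entry `(k, j)`, the product with `M` on the left picks out `M k l`, and the other one
  -- sums `M k' j` over `k'` that `f` maps to `k`.
  have h1 := congrFun (congrFun (hM.comm_functionMatrix f) k) (fun t c => j c t)
  rw [Matrix.mul_apply, Matrix.mul_apply] at h1
  simp only [tensorPower_functionMatrix, hf] at h1
  have h2 : ∑ x : β → MultiIndex D N, (M k x * if x = fun s c => l s c then 1 else 0) = M k l := by
    simp
  rw [h2] at h1
  rw [← h1]
  symm
  -- Only rearrangements `k'` of `j` contribute, and each comes from exactly one `σ` since `j` is
  -- injective.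
  refine Finset.sum_of_injOn (fun (σ : Fin D → α ≃ β) s c => j c (σ c s)) ?_ (by simp) ?_ ?_
  · intro σ _ τ _ h
    funext c
    ext s
    exact hj c (congrFun (congrFun h s) c)
  · intro k' _ hk'
    by_contra h0
    obtain ⟨σ, hσ⟩ := hM.exists_equiv (right_ne_zero_of_mul h0)
    exact hk' ⟨σ, by simp, by funext s c; exact (hσ c s).symm⟩
  · intro σ _
    rw [mul_comm]
    congr 2
    simp only [hf, funext_iff, eq_iff_iff]
    exact forall_comm

end Invariant

/-! ### Inversion by Weingarten functions -/

theorem numCycles_inv {ι : Type*} [Fintype ι] (ρ : Equiv.Perm ι) :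
    numCycles ρ⁻¹ = numCycles ρ := by
  have h : Equiv.Perm.SameCycle.setoid ρ⁻¹ = Equiv.Perm.SameCycle.setoid ρ :=
    Setoid.ext fun _ _ => Equiv.Perm.sameCycle_inv
  unfold numCycles
  rw [h]

theorem numCycles_conj {ι : Type*} [Fintype ι] (ρ ν : Equiv.Perm ι) :
    numCycles (ν * ρ * ν⁻¹) = numCycles ρ := by
  refine (Fintype.card_congr (Quotient.congr ν fun a b => ?_)).symm
  change ρ.SameCycle a b ↔ (ν * ρ * ν⁻¹).SameCycle (ν a) (ν b)
  simp [Equiv.Perm.sameCycle_conj]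

theorem numCycles_mul_comm {ι : Type*} [Fintype ι] (ρ ν : Equiv.Perm ι) :
    numCycles (ρ * ν) = numCycles (ν * ρ) := by
  rw [← numCycles_conj (ρ * ν) ν]
  congr 1
  group

-- Transport of Weingarten inversion from permutations to bijections between two label sets, by `τ ↦
-- σ τ⁻¹`. Invariance of the cycle count under inversion and conjugation matches the Gram entries.
open scoped Classical in
theorem sum_pow_numCycles_mul_weingarten {N : ℕ} {α β : Type*} [Fintype α] [Fintype β]
    (h : Fintype.card β ≤ N) (ρ σ : α ≃ β) :
    ∑ τ : α ≃ β, (N : ℂ) ^ numCycles (τ.symm.trans ρ) * weingarten N (τ.symm.trans σ) =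
      if ρ = σ then 1 else 0 := by
  let e : (α ≃ β) ≃ Equiv.Perm β :=
    { toFun := fun τ => τ.symm.trans σ
      invFun := fun π => σ.trans π.symm
      left_inv := fun τ => by ext; simp
      right_inv := fun π => by ext; simp }
  let κ : Equiv.Perm β := σ.symm.trans ρ
  have h1 : ∀ τ : α ≃ β, numCycles (τ.symm.trans ρ) = numCycles (κ⁻¹ * (e τ)⁻¹) := fun τ => by
    rw [← mul_inv_rev, numCycles_inv, numCycles_mul_comm]
    congr 1
    ext t
    simp [κ, e]
  have h2 := sum_gram_mul_weingarten N h κ⁻¹ 1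
  simp only [inv_one, mul_one] at h2
  simp only [h1]
  refine (e.sum_comp fun π => (N : ℂ) ^ numCycles (κ⁻¹ * π⁻¹) * weingarten N π).trans ?_
  rw [h2]
  congr 1
  rw [inv_eq_one, eq_iff_iff]
  constructor
  · intro h3
    ext s
    simpa [κ] using congrArg (fun π : Equiv.Perm β => π (σ s)) h3
  · rintro rfl
    ext t
    simp [κ]

-- The bijections `ρ` determine `k` from `l`; what remains is that, in each colour, `l` is constant
-- on the cycles of `ρ τ⁻¹`.
open scoped Classical in
theorem sum_colourings {D N : ℕ} {α β : Type*} [Fintype α] [Fintype β] (ρ τ : Fin D → α ≃ β) :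
    (∑ k : α → MultiIndex D N, ∑ l : β → MultiIndex D N,
      (if ∀ c s, k s c = l (ρ c s) c then (1 : ℂ) else 0) *
        ∏ c, ∏ s, if k s c = l (τ c s) c then 1 else 0) =
      ∏ c, (N : ℂ) ^ numCycles ((τ c).symm.trans (ρ c)) := by
  have h1 : ∀ l : β → MultiIndex D N, ∑ k : α → MultiIndex D N,
      (if ∀ c s, k s c = l (ρ c s) c then (1 : ℂ) else 0) *
        (∏ c, ∏ s, if k s c = l (τ c s) c then 1 else 0) =
      ∏ c, if (fun t => l t c) ∘ ((τ c).symm.trans (ρ c) : Equiv.Perm β) =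
        (fun t => l t c) ∘ (1 : Equiv.Perm β) then 1 else 0 := by
    intro l
    rw [Finset.sum_eq_single fun s c => l (ρ c s) c]
    · simp only [implies_true, if_true, one_mul]
      refine Finset.prod_congr rfl fun c _ => ?_
      rw [Finset.prod_ite_zero, Finset.prod_const_one]
      congr 1
      rw [eq_iff_iff, funext_iff, ← (τ c).forall_congr_right]
      simp
    · intro k _ hk
      rw [if_neg fun h => hk (funext fun s => funext fun c => h c s), zero_mul]
    · simp
  rw [Finset.sum_comm, Finset.sum_congr rfl fun l _ => h1 l]
  refine ((Equiv.piComm fun (_ : β) (_ : Fin D) => Fin N).sum_comp fun m : Fin D → β → Fin N =>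
    ∏ c, if m c ∘ ((τ c).symm.trans (ρ c) : Equiv.Perm β) = m c ∘ (1 : Equiv.Perm β) then
      (1 : ℂ) else 0).trans ?_
  rw [← Fintype.piFinset_univ, ← Finset.prod_univ_sum (fun _ => Finset.univ) fun c f =>
    if f ∘ ((τ c).symm.trans (ρ c) : Equiv.Perm β) = f ∘ (1 : Equiv.Perm β) then (1 : ℂ) else 0]
  refine Finset.prod_congr rfl fun c _ => ?_
  rw [Finset.sum_boole, card_invariant_colourings, inv_one, mul_one, Nat.cast_pow]

open scoped Classical in
/-- The entries of an invariant matrix at pairwise distinct indices, in terms of its traces. -/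
theorem IsUnitaryInvariant.apply_eq_sum_trace {D N : ℕ} {α β : Type*} [Fintype α] [Fintype β]
    {M : Matrix (α → MultiIndex D N) (β → MultiIndex D N) ℂ} (hM : IsUnitaryInvariant M)
    (h : Fintype.card β ≤ N) {j : Fin D → β → Fin N} (hj : ∀ c, Function.Injective (j c))
    (σ : Fin D → α ≃ β) :
    M (fun s c => j c (σ c s)) (fun t c => j c t) =
      ∑ τ : Fin D → α ≃ β,
        (∑ k, ∑ l, M k l * ∏ c, ∏ s, if k s c = l (τ c s) c then 1 else 0) *
          ∏ c, weingarten N ((τ c).symm.trans (σ c)) := by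
  -- Tracing the expansion against `τ` gives a Gram system whose unknowns are the entries at
  -- distinct indices.
  have h1 : ∀ τ : Fin D → α ≃ β,
      (∑ k, ∑ l, M k l * ∏ c, ∏ s, if k s c = l (τ c s) c then (1 : ℂ) else 0) =
        ∑ ρ : Fin D → α ≃ β, M (fun s c => j c (ρ c s)) (fun t c => j c t) *
          ∏ c, (N : ℂ) ^ numCycles ((τ c).symm.trans (ρ c)) := by
    intro τ
    simp only [← sum_colourings, Finset.mul_sum]
    refine (Finset.sum_congr rfl fun k _ => Finset.sum_congr rfl fun l _ => by
      rw [hM.apply_eq_sum hj k l, Finset.sum_mul]).trans ?_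
    rw [Finset.sum_comm (s := (Finset.univ : Finset (Fin D → α ≃ β)))]
    refine Finset.sum_congr rfl fun k _ => ?_
    rw [Finset.sum_comm (s := (Finset.univ : Finset (Fin D → α ≃ β)))]
    simp only [mul_assoc]
  have h2 : ∀ ρ : Fin D → α ≃ β,
      ∑ τ : Fin D → α ≃ β, (∏ c, (N : ℂ) ^ numCycles ((τ c).symm.trans (ρ c))) *
        ∏ c, weingarten N ((τ c).symm.trans (σ c)) = if ρ = σ then 1 else 0 := by
    intro ρ
    simp only [← Finset.prod_mul_distrib]
    rw [← Fintype.piFinset_univ, ← Finset.prod_univ_sum (fun _ => Finset.univ)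
      fun c (τ : α ≃ β) => (N : ℂ) ^ numCycles (τ.symm.trans (ρ c)) *
        weingarten N (τ.symm.trans (σ c))]
    simp only [sum_pow_numCycles_mul_weingarten h, Finset.prod_ite_zero, Finset.prod_const_one]
    congr 1
    simp [funext_iff]
  simp only [h1, Finset.sum_mul, mul_assoc]
  rw [Finset.sum_comm]
  simp only [← Finset.mul_sum, h2]
  simp

/-! ### Families of bijections between fibres -/

/-- Bijections that preserve fibres are families of bijections between fibres. -/
theorem bijective_subtypeEquiv_fibres {κ α β Q : Type*} (f : α → Q) (g : β → Q)
    {P : (κ → α ≃ β) → Prop} (hP : ∀ τ, P τ ↔ ∀ c s, g (τ c s) = f s)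
    (R : {τ // P τ} → ∀ G, κ → {s // f s = G} ≃ {t // g t = G})
    (hR : ∀ τ G c s, (R τ G c s : β) = τ.1 c s) : Function.Bijective R := by
  constructor
  · intro τ τ' h
    refine Subtype.ext (funext fun c => Equiv.ext fun s => ?_)
    rw [← hR τ (f s) c ⟨s, rfl⟩, h, hR]
  · intro e
    refine ⟨⟨fun c => Equiv.ofFiberEquiv fun G => e G c,
      (hP _).2 fun c s => Equiv.ofFiberEquiv_map _ s⟩, ?_⟩
    funext G c
    ext ⟨s, rfl⟩
    rw [hR]
    rfl

theorem sum_sum_subtype_comm {S T : Type*} [Fintype S] [Fintype T] {R : T → S → Prop}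
    [∀ τ, Fintype {π // R τ π}] [∀ π, Fintype {τ // R τ π}] (f : ∀ τ π, R τ π → ℂ) :
    ∑ τ, ∑ π : {π // R τ π}, f τ π.1 π.2 = ∑ π, ∑ τ : {τ // R τ π}, f τ.1 π τ.2 := by
  let e : (Σ τ, {π // R τ π}) ≃ (Σ π, {τ // R τ π}) :=
    { toFun := fun x => ⟨x.2.1, x.1, x.2.2⟩
      invFun := fun x => ⟨x.2.1, x.1, x.2.2⟩
      left_inv := fun _ => rfl
      right_inv := fun _ => rfl }
  rw [← Fintype.sum_sigma', ← Fintype.sum_sigma']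
  exact Fintype.sum_equiv e _ _ fun _ => rfl

theorem sum_prod_eq_prod_sum_of_bijective {Q R : Type*} {κ : Q → Type*} [Fintype Q]
    [∀ G, Fintype (κ G)] [Fintype R] (F : R → ∀ G, κ G) (hF : Function.Bijective F)
    (f : ∀ G, κ G → ℂ) : ∑ r, ∏ G, f G (F r G) = ∏ G, ∑ x, f G x := by
  classical
  rw [Fintype.prod_sum]
  exact Fintype.sum_bijective F hF _ _ fun _ => rfl

/-! ### Moments -/

/-- Hölder's inequality: the reciprocal exponents add up to `card ι / m ≤ 1`. Factors fewer than `m`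
are allowed, as happens on the blocks of a partition. -/
theorem integrable_prod_of_memLp {Ω : Type*} [MeasurableSpace Ω] {μ : Measure Ω}
    [IsFiniteMeasure μ] {ι : Type*} [Fintype ι] {m : ℕ} (h : Fintype.card ι ≤ m) {f : ι → Ω → ℂ}
    (hf : ∀ s, MemLp (f s) (m : ENNReal) μ) : Integrable (fun ω => ∏ s, f s ω) μ := by
  rw [← memLp_one_iff_integrable]
  refine (MemLp.prod' (s := Finset.univ) (p := fun _ => (m : ENNReal))
    fun s _ => hf s).mono_exponent ?_
  rw [ENNReal.one_le_inv, Finset.sum_const, Finset.card_univ, nsmul_eq_mul]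
  calc (Fintype.card ι : ENNReal) * (m : ENNReal)⁻¹ ≤ m * (m : ENNReal)⁻¹ := by gcongr
    _ ≤ 1 := ENNReal.mul_inv_le_one _

open scoped Classical in
theorem isUnitaryInvariant_integral {Ω : Type*} [MeasurableSpace Ω] {μ : Measure Ω} {D N : ℕ}
    {α β : Type*} [Fintype α] [Fintype β]
    {x : (α → MultiIndex D N) → (β → MultiIndex D N) → Ω → ℂ} (hx : ∀ k l, Integrable (x k l) μ)
    (h : ∀ (U : Fin D → Matrix.unitaryGroup (Fin N) ℂ) k l,
      ∫ ω, ∑ k', ∑ l', (∏ s, tensorEntry U (k s) (k' s)) * x k' l' ω *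
        star (∏ t, tensorEntry U (l t) (l' t)) ∂μ = ∫ ω, x k l ω ∂μ) :
    IsUnitaryInvariant (Matrix.of fun k l => ∫ ω, x k l ω ∂μ) := by
  intro U
  ext k l
  rw [Matrix.of_apply, ← h U k l, integral_finsetSum _ fun k' _ => integrable_finsetSum _
    fun l' _ => ((hx k' l').const_mul _).mul_const _, Finset.sum_congr rfl fun k' _ =>
    integral_finsetSum _ fun l' _ => ((hx k' l').const_mul _).mul_const _]
  simp only [integral_mul_const, integral_const_mul, Matrix.mul_apply, Finset.sum_mul]
  rw [Finset.sum_comm]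
  rfl

theorem integral_sum_mul {Ω : Type*} [MeasurableSpace Ω] {μ : Measure Ω} {κ κ' : Type*}
    [Fintype κ] [Fintype κ'] {x : κ → κ' → Ω → ℂ} (hx : ∀ k l, Integrable (x k l) μ)
    (a : κ → κ' → ℂ) :
    ∫ ω, ∑ k, ∑ l, x k l ω * a k l ∂μ = ∑ k, ∑ l, (∫ ω, x k l ω ∂μ) * a k l := by
  rw [integral_finsetSum _ fun k _ => integrable_finsetSum _
    fun l _ => (hx k l).mul_const _]
  refine Finset.sum_congr rfl fun k _ => ?_
  rw [integral_finsetSum _ fun l _ => (hx k l).mul_const _]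
  simp only [integral_mul_const]

section Moments

variable {Ω : Type*} [MeasurableSpace Ω] {μ : Measure Ω} {D N : ℕ} {α β : Type*} [Fintype α]
  [Fintype β]

/-- The joint moments of the entries of a mixed tensor. -/
noncomputable def mixedMoment (μ : Measure Ω) (A : Ω → MixedTensor D N) (α : Type*) [Fintype α] :
    Matrix (α → MultiIndex D N) (α → MultiIndex D N) ℂ :=
  Matrix.of fun k l => ∫ ω, ∏ s, A ω (k s) (l s) ∂μ

/-- The joint moments of the entries of a pair of pure tensors. -/
noncomputable def pureMoment (μ : Measure Ω) (T T' : Ω → PureTensor D N) (α β : Type*) [Fintype α]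
    [Fintype β] : Matrix (α → MultiIndex D N) (β → MultiIndex D N) ℂ :=
  Matrix.of fun k l => ∫ ω, (∏ s, T ω (k s)) * ∏ t, T' ω (l t) ∂μ

open scoped Classical in
theorem prod_mixedAction (U : Fin D → Matrix.unitaryGroup (Fin N) ℂ)
    (A : MixedTensor D N) (k l : α → MultiIndex D N) :
    ∏ s, mixedAction U A (k s) (l s) =
      ∑ k' : α → MultiIndex D N, ∑ l' : α → MultiIndex D N,
        (∏ s, tensorEntry U (k s) (k' s)) * (∏ s, A (k' s) (l' s)) *
          star (∏ s, tensorEntry U (l s) (l' s)) := by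
  simp only [mixedAction, Finset.prod_univ_sum, Fintype.piFinset_univ, Finset.prod_mul_distrib,
    star_prod]

open scoped Classical in
theorem prod_whiteAction_mul_prod_blackAction
    (U : Fin D → Matrix.unitaryGroup (Fin N) ℂ) (T T' : PureTensor D N) (k : α → MultiIndex D N)
    (l : β → MultiIndex D N) :
    (∏ s, whiteAction U T (k s)) * ∏ t, blackAction U T' (l t) =
      ∑ k' : α → MultiIndex D N, ∑ l' : β → MultiIndex D N,
        (∏ s, tensorEntry U (k s) (k' s)) * ((∏ s, T (k' s)) * ∏ t, T' (l' t)) *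
          star (∏ t, tensorEntry U (l t) (l' t)) := by
  simp only [whiteAction, blackAction, Finset.prod_univ_sum, Fintype.piFinset_univ,
    Finset.prod_mul_distrib, Finset.sum_mul_sum, star_prod]
  exact Finset.sum_congr rfl fun _ _ => Finset.sum_congr rfl fun _ _ => by ring

theorem integrable_mixedMoment [IsFiniteMeasure μ] {A : Ω → MixedTensor D N} {m : ℕ}
    (hA : ∀ k l, MemLp (fun ω => A ω k l) (m : ENNReal) μ) (h : Fintype.card α ≤ m)
    (k l : α → MultiIndex D N) : Integrable (fun ω => ∏ s, A ω (k s) (l s)) μ :=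
  integrable_prod_of_memLp h fun s => hA (k s) (l s)

theorem integrable_pureMoment [IsFiniteMeasure μ] {T T' : Ω → PureTensor D N} {m : ℕ}
    (hT : ∀ k, MemLp (fun ω => T ω k) (m : ENNReal) μ)
    (hT' : ∀ k, MemLp (fun ω => T' ω k) (m : ENNReal) μ)
    (h : Fintype.card α + Fintype.card β ≤ m) (k : α → MultiIndex D N) (l : β → MultiIndex D N) :
    Integrable (fun ω => (∏ s, T ω (k s)) * ∏ t, T' ω (l t)) μ := by
  have := integrable_prod_of_memLp (μ := μ) (ι := α ⊕ β) (by simpa using h)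
    (f := Sum.elim (fun s ω => T ω (k s)) fun t ω => T' ω (l t))
    (by rintro (s | t); exacts [hT _, hT' _])
  simpa [Fintype.prod_sum_type] using this

theorem MixedLUInvariant.isUnitaryInvariant [IsFiniteMeasure μ]
    {A : Ω → MixedTensor D N} (hinv : MixedLUInvariant μ A) {m : ℕ}
    (hA : ∀ k l, MemLp (fun ω => A ω k l) (m : ENNReal) μ) (h : Fintype.card α ≤ m) :
    IsUnitaryInvariant (mixedMoment μ A α) := by
  refine isUnitaryInvariant_integral (integrable_mixedMoment hA h) fun U k l => ?_
  simp only [← prod_mixedAction]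
  have hmeas : Measurable fun B : MixedTensor D N => ∏ s, B (k s) (l s) := by fun_prop
  exact ((hinv U).comp hmeas).integral_eq

theorem PureLUInvariant.isUnitaryInvariant [IsFiniteMeasure μ]
    {T T' : Ω → PureTensor D N} (hinv : PureLUInvariant μ T T') {m : ℕ}
    (hT : ∀ k, MemLp (fun ω => T ω k) (m : ENNReal) μ)
    (hT' : ∀ k, MemLp (fun ω => T' ω k) (m : ENNReal) μ)
    (h : Fintype.card α + Fintype.card β ≤ m) : IsUnitaryInvariant (pureMoment μ T T' α β) := by
  refine isUnitaryInvariant_integral (integrable_pureMoment hT hT' h) fun U k l => ?_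
  simp only [← prod_whiteAction_mul_prod_blackAction]
  have hmeas : Measurable fun B : PureTensor D N × PureTensor D N =>
      (∏ s, B.1 (k s)) * ∏ t, B.2 (l t) := by fun_prop
  exact ((hinv U).comp hmeas).integral_eq

end Moments

/-! ### Partitions preserved by permutations -/

theorem mixedPartition_le_iff {D : ℕ} {ι : Type*} [Finite ι] {σ : Fin D → Equiv.Perm ι}
    {π : Setoid ι} :
    mixedPartition σ ≤ π ↔ ∀ c s, Quotient.mk π (σ c s) = Quotient.mk π s := by
  refine ⟨fun h c s => (mk_apply_eq_iff_mixed h c _ s).2 rfl, fun h => iSup_le fun c => ?_⟩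
  intro a b hab
  obtain ⟨k, rfl⟩ := Equiv.Perm.SameCycle.exists_nat_pow_eq hab
  clear hab
  induction k with
  | zero => exact π.refl _
  | succ k ih =>
    rw [pow_succ', Equiv.Perm.mul_apply]
    exact π.trans ih (π.symm (Quotient.exact (h c _)))

theorem purePartition_le_iff {D : ℕ} {α β : Type*} {σ : Fin D → α ≃ β} {P : Setoid (α ⊕ β)} :
    purePartition σ ≤ P ↔
      ∀ c s, Quotient.mk P (Sum.inr (σ c s)) = Quotient.mk P (Sum.inl s) := by
  refine ⟨fun h c s => (mk_inl_eq_iff_pure h c _ s).1 rfl, fun h => iSup_le fun c => ?_⟩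
  have key : ∀ x : α ⊕ β, P x (Sum.inr (Sum.elim (σ c) id x)) := by
    rintro (s | t)
    · exact P.symm (Quotient.exact (h c s))
    · exact P.refl _
  intro x y hxy
  have hxy' : Sum.elim (σ c) id x = Sum.elim (σ c) id y := hxy
  exact P.trans (key x) (hxy' ▸ P.symm (key y))

/-- A single colour already matches the white and black elements of each block. With no colour, the
join is the discrete partition and this fails. -/
theorem isBipartite_of_purePartition_le {D : ℕ} (hD : 1 ≤ D) {α β : Type*} [Fintype α]
    [Fintype β] {σ : Fin D → α ≃ β} {P : Setoid (α ⊕ β)} (h : purePartition σ ≤ P) :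
    IsBipartite P :=
  fun G => Fintype.card_congr (pureRestrict σ P h G ⟨0, hD⟩)

/-- A product over a block of a partition of white and black labels. -/
theorem prod_block_sum {α β : Type*} [Fintype α] [Fintype β] (P : Setoid (α ⊕ β))
    (G : Quotient P) (f : α ⊕ β → ℂ) :
    ∏ s : Block P G, f s.1 =
      (∏ s : WhiteBlock P G, f (Sum.inl s.1)) * ∏ t : BlackBlock P G, f (Sum.inr t.1) := by
  let e : WhiteBlock P G ⊕ BlackBlock P G ≃ Block P G :=
    (Equiv.subtypeSum (p := fun s => Quotient.mk P s = G)).symm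
  rw [← e.prod_comp, Fintype.prod_sum_type]
  rfl

/-! ### Free cumulants and classical cumulants -/

open scoped Classical in
/-- Moments at pairwise distinct indices of an invariant mixed tensor, in terms of its
trace-invariants. -/
theorem integral_prod_eq_sum_mixedTrace {D N : ℕ} {ι : Type*} [Fintype ι]
    (hN : Fintype.card ι ≤ N) (σ : Fin D → Equiv.Perm ι) {i : Fin D → ι → Fin N}
    (hi : ∀ c, Function.Injective (i c)) {Ω : Type*} [MeasurableSpace Ω] {μ : Measure Ω}
    [IsFiniteMeasure μ] {A : Ω → MixedTensor D N} (hinv : MixedLUInvariant μ A) {m : ℕ}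
    (hA : ∀ k l, MemLp (fun ω => A ω k l) (m : ENNReal) μ) (hm : Fintype.card ι ≤ m) :
    ∫ ω, ∏ s, A ω (fun c => i c (σ c s)) (fun c => i c s) ∂μ =
      ∑ τ : Fin D → Equiv.Perm ι, (∫ ω, mixedTrace τ (A ω) ∂μ) *
        ∏ c, weingarten N (σ c * (τ c)⁻¹) := by
  refine ((hinv.isUnitaryInvariant hA hm).apply_eq_sum_trace hN hi σ).trans ?_
  refine Finset.sum_congr rfl fun τ _ => ?_
  congr 1
  exact (integral_sum_mul (integrable_mixedMoment hA hm) _).symm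

open scoped Classical in
/-- Moments at pairwise distinct indices of an invariant pair of pure tensors, in terms of its
trace-invariants. -/
theorem pureMoment_eq_sum_pureTrace {D N : ℕ} {α β : Type*} [Fintype α] [Fintype β]
    (hN : Fintype.card β ≤ N) (σ : Fin D → α ≃ β) {i : Fin D → β → Fin N}
    (hi : ∀ c, Function.Injective (i c)) {Ω : Type*} [MeasurableSpace Ω] {μ : Measure Ω}
    [IsFiniteMeasure μ] {T T' : Ω → PureTensor D N} (hinv : PureLUInvariant μ T T') {m : ℕ}
    (hT : ∀ k, MemLp (fun ω => T ω k) (m : ENNReal) μ)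
    (hT' : ∀ k, MemLp (fun ω => T' ω k) (m : ENNReal) μ)
    (hm : Fintype.card α + Fintype.card β ≤ m) :
    pureMoment μ T T' α β (fun s c => i c (σ c s)) (fun t c => i c t) =
      ∑ τ : Fin D → α ≃ β, (∫ ω, pureTrace τ (T ω) (T' ω) ∂μ) *
        ∏ c, weingarten N ((τ c).symm.trans (σ c)) := by
  rw [(hinv.isUnitaryInvariant hT hT' hm).apply_eq_sum_trace hN hi σ]
  refine Finset.sum_congr rfl fun τ _ => ?_
  congr 1
  exact (integral_sum_mul (integrable_pureMoment hT hT' hm) _).symm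

theorem mixedFreeCumulant_eq_classicalCumulant {D N : ℕ} {ι : Type*} [Fintype ι]
    (hN : Fintype.card ι ≤ N) (σ : Fin D → Equiv.Perm ι) {i : Fin D → ι → Fin N}
    (hi : ∀ c, Function.Injective (i c)) {Ω : Type*} [MeasurableSpace Ω] {μ : Measure Ω}
    [IsFiniteMeasure μ] {A : Ω → MixedTensor D N} (hinv : MixedLUInvariant μ A)
    (hA : ∀ k l, MemLp (fun ω => A ω k l) (Fintype.card ι : ENNReal) μ) :
    mixedFreeCumulant μ σ A =
      classicalCumulant μ fun s ω => A ω (fun c => i c (σ c s)) fun c => i c s := by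
  classical
  unfold mixedFreeCumulant classicalCumulant
  rw [sum_sum_subtype_comm fun (τ : Fin D → Equiv.Perm ι) (π : Setoid ι)
    (h : mixedPartition σ ≤ π ∧ mixedPartition τ ≤ π) => moebius π * ∏ G : Quotient π,
        (∫ ω, mixedTrace (mixedRestrict τ π h.2 G) (A ω) ∂μ) *
          ∏ c, weingarten N (mixedRestrict σ π h.1 G c * (mixedRestrict τ π h.2 G c)⁻¹)]
  refine Finset.sum_congr rfl fun π _ => ?_
  rw [← Finset.mul_sum]
  congr 1
  have hcard : ∀ G : Quotient π, Fintype.card (Block π G) ≤ Fintype.card ι := fun G =>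
    Fintype.card_le_of_injective _ Subtype.val_injective
  have hM : ∀ G : Quotient π, IsUnitaryInvariant (mixedMoment μ A (Block π G)) := fun G =>
    hinv.isUnitaryInvariant hA (hcard G)
  by_cases hσ : mixedPartition σ ≤ π
  · have hG := fun G : Quotient π => integral_prod_eq_sum_mixedTrace ((hcard G).trans hN)
      (mixedRestrict σ π hσ G) (i := fun c s => i c s.1)
      (fun c => (hi c).comp Subtype.val_injective) hinv hA (hcard G)
    refine Eq.trans ?_ (Finset.prod_congr rfl fun G _ => hG G).symm
    -- A tuple `τ` preserving `π` is the same as an independent choice of a tuple on each block, so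
    -- the sum of products is a product of sums.
    have key := sum_prod_eq_prod_sum_of_bijective
      (fun (τ : {τ : Fin D → Equiv.Perm ι // mixedPartition σ ≤ π ∧ mixedPartition τ ≤ π}) G =>
        mixedRestrict τ.1 π τ.2.2 G)
      (bijective_subtypeEquiv_fibres (Quotient.mk π) (Quotient.mk π)
        (fun τ => (and_iff_right hσ).trans mixedPartition_le_iff) _ fun _ _ _ _ => rfl)
      fun G τ => (∫ ω, mixedTrace τ (A ω) ∂μ) *
        ∏ c, weingarten N (mixedRestrict σ π hσ G c * (τ c)⁻¹)
    convert key
  · have : IsEmpty {τ : Fin D → Equiv.Perm ι // mixedPartition σ ≤ π ∧ mixedPartition τ ≤ π} :=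
      ⟨fun τ => hσ τ.2.1⟩
    rw [Finset.sum_of_isEmpty]
    symm
    -- If every block moment is nonzero, then in the block of `s` the indices `i c (σ c s)` match
    -- those of black labels in that block. Injectivity of `i c` puts `σ c s` there, so `σ` would
    -- preserve `π`.
    by_contra h0
    refine hσ (mixedPartition_le_iff.2 fun c s => ?_)
    obtain ⟨τ, hτ⟩ := (hM (Quotient.mk π s)).exists_equiv
      (k := fun s c => i c (σ c s.1)) (l := fun s c => i c s.1)
      (Finset.prod_ne_zero_iff.1 h0 _ (Finset.mem_univ _))
    rw [hi c (hτ c ⟨s, rfl⟩)]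
    exact (τ c ⟨s, rfl⟩).2

theorem pureFreeCumulant_eq_classicalCumulant {D N : ℕ} (hD : 1 ≤ D) {α β : Type*} [Fintype α]
    [Fintype β] (hN : Fintype.card β ≤ N) (σ : Fin D → α ≃ β) {i : Fin D → β → Fin N}
    (hi : ∀ c, Function.Injective (i c)) {Ω : Type*} [MeasurableSpace Ω] {μ : Measure Ω}
    [IsFiniteMeasure μ] {T T' : Ω → PureTensor D N} (hinv : PureLUInvariant μ T T') {m : ℕ}
    (hm : Fintype.card α + Fintype.card β ≤ m)
    (hT : ∀ k, MemLp (fun ω => T ω k) (m : ENNReal) μ)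
    (hT' : ∀ k, MemLp (fun ω => T' ω k) (m : ENNReal) μ) :
    pureFreeCumulant μ σ T T' =
      classicalCumulant μ (Sum.elim (fun s ω => T ω fun c => i c (σ c s))
        fun t ω => T' ω fun c => i c t) := by
  classical
  unfold pureFreeCumulant classicalCumulant
  rw [sum_sum_subtype_comm fun (τ : Fin D → α ≃ β) (P : Setoid (α ⊕ β))
    (h : IsBipartite P ∧ purePartition σ ≤ P ∧ purePartition τ ≤ P) =>
      moebius P * ∏ G : Quotient P,
        (∫ ω, pureTrace (pureRestrict τ P h.2.2 G) (T ω) (T' ω) ∂μ) *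
          ∏ c, weingarten N
            ((pureRestrict τ P h.2.2 G c).symm.trans (pureRestrict σ P h.2.1 G c))]
  refine Finset.sum_congr rfl fun P _ => ?_
  rw [← Finset.mul_sum]
  congr 1
  have hcardα : ∀ G : Quotient P, Fintype.card (WhiteBlock P G) ≤ Fintype.card α := fun G =>
    Fintype.card_le_of_injective _ Subtype.val_injective
  have hcardβ : ∀ G : Quotient P, Fintype.card (BlackBlock P G) ≤ Fintype.card β := fun G =>
    Fintype.card_le_of_injective _ Subtype.val_injective
  have hcard : ∀ G : Quotient P,
      Fintype.card (WhiteBlock P G) + Fintype.card (BlackBlock P G) ≤ m := fun G =>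
    (add_le_add (hcardα G) (hcardβ G)).trans hm
  have hM : ∀ G : Quotient P,
      IsUnitaryInvariant (pureMoment μ T T' (WhiteBlock P G) (BlackBlock P G)) := fun G =>
    hinv.isUnitaryInvariant hT hT' (hcard G)
  have hmom : ∀ G : Quotient P,
      ∫ ω, ∏ s : Block P G, (Sum.elim (fun s ω => T ω fun c => i c (σ c s))
        (fun t ω => T' ω fun c => i c t) : α ⊕ β → Ω → ℂ) s.1 ω ∂μ =
      pureMoment μ T T' (WhiteBlock P G) (BlackBlock P G) (fun s c => i c (σ c s.1))
        (fun t c => i c t.1) := fun G =>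
    integral_congr_ae (Filter.Eventually.of_forall fun ω => prod_block_sum P G fun s =>
      (Sum.elim (fun s ω => T ω fun c => i c (σ c s))
        (fun t ω => T' ω fun c => i c t) : α ⊕ β → Ω → ℂ) s ω)
  simp only [hmom]
  -- Non-bipartite partitions fall in the negative case, where the classical term vanishes too.
  by_cases hσ : purePartition σ ≤ P
  · have hG := fun G : Quotient P => pureMoment_eq_sum_pureTrace ((hcardβ G).trans hN)
      (pureRestrict σ P hσ G) (i := fun c t => i c t.1)
      (fun c => (hi c).comp Subtype.val_injective) hinv hT hT' (hcard G)
    refine Eq.trans ?_ (Finset.prod_congr rfl fun G _ => hG G).symm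
    have key := sum_prod_eq_prod_sum_of_bijective
      (fun (τ : {τ : Fin D → α ≃ β //
        IsBipartite P ∧ purePartition σ ≤ P ∧ purePartition τ ≤ P}) G =>
        pureRestrict τ.1 P τ.2.2.2 G)
      (bijective_subtypeEquiv_fibres (fun s => Quotient.mk P (Sum.inl s))
        (fun t => Quotient.mk P (Sum.inr t))
        (fun τ => (and_iff_right (isBipartite_of_purePartition_le hD hσ)).trans
          ((and_iff_right hσ).trans purePartition_le_iff)) _ fun _ _ _ _ => rfl)
      fun G τ => (∫ ω, pureTrace τ (T ω) (T' ω) ∂μ) *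
        ∏ c, weingarten N ((τ c).symm.trans (pureRestrict σ P hσ G c))
    convert key
  · have : IsEmpty {τ : Fin D → α ≃ β //
        IsBipartite P ∧ purePartition σ ≤ P ∧ purePartition τ ≤ P} :=
      ⟨fun τ => hσ τ.2.2.1⟩
    rw [Finset.sum_of_isEmpty]
    symm
    by_contra h0
    refine hσ (purePartition_le_iff.2 fun c s => ?_)
    obtain ⟨τ, hτ⟩ := (hM (Quotient.mk P (Sum.inl s))).exists_equiv
      (Finset.prod_ne_zero_iff.1 h0 _ (Finset.mem_univ _))
    rw [hi c (hτ c ⟨s, rfl⟩)]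
    exact (τ c ⟨s, rfl⟩).2

end TensorCumulant

theorem mainTheorem11 {D n N : ℕ} (hD : 1 ≤ D) (hn : 1 ≤ n)
    (σ : Fin D → Equiv.Perm (Fin n)) (i : Fin D → Fin n → Fin N)
    (hi : ∀ c, Function.Injective (i c))
    {Ω : Type*} [MeasurableSpace Ω] (μ : Measure Ω) [IsProbabilityMeasure μ] :
    (∀ A : Ω → TensorCumulant.MixedTensor D N,
      TensorCumulant.MixedLUInvariant μ A →
      (∀ k l, MemLp (fun ω => A ω k l) (n : ENNReal) μ) →
      TensorCumulant.mixedFreeCumulant μ σ A =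
        TensorCumulant.classicalCumulant μ
          (fun (s : Fin n) ω => A ω (fun c => i c (σ c s)) (fun c => i c s))) ∧
    (∀ T T' : Ω → TensorCumulant.PureTensor D N,
      TensorCumulant.PureLUInvariant μ T T' →
      (∀ k, MemLp (fun ω => T ω k) (2 * n : ENNReal) μ) →
      (∀ k, MemLp (fun ω => T' ω k) (2 * n : ENNReal) μ) →
      TensorCumulant.pureFreeCumulant μ σ T T' =
        TensorCumulant.classicalCumulant μ
          (Sum.elim (fun (s : Fin n) ω => T ω (fun c => i c (σ c s)))
            (fun (s : Fin n) ω => T' ω (fun c => i c s)))) := by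
  -- Any one colour gives `n` distinct indices among `N`, the range in which the Gram matrix is
  -- invertible.
  have hN : Fintype.card (Fin n) ≤ N := by
    simpa using Fintype.card_le_of_injective _ (hi ⟨0, hD⟩)
  refine ⟨fun A hinv hA => ?_, fun T T' hinv hT hT' => ?_⟩
  · exact TensorCumulant.mixedFreeCumulant_eq_classicalCumulant hN σ hi hinv (by simpa using hA)
  · refine TensorCumulant.pureFreeCumulant_eq_classicalCumulant hD hN σ hi hinv (m := 2 * n)
      (by simp [two_mul]) ?_ ?_
    · simpa using hT
    · simpa using hT'
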